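/- Let $E$ be the elliptic curve $y^2 = x^3 - t^2x + t^2$ over $\mathbb{Q}(t)$. For $t_0 \in \mathbb{Q}$ such that $E_{t_0} : y^2 = x^3 - t_0^2x + t_0^2$ is an elliptic curve over $\mathbb{Q}$ (nonzero discriminant), let $\sigma_{t_0} : E(\mathbb{Q}(t)) \to E_{t_0}(\mathbb{Q})$ be the specialization map, $(x(t),y(t)) \mapsto (x(t_0),y(t_0))$, where the point at infinity and the points whose coordinates have a pole at $t_0$ are sent to the point at infinity. Let $t_0 = 1/(\alpha_0 - \alpha_0^3)$ with $\alpha_0 \in \mathbb{Q}$, and let $$\Phi = \{-1,\ \alpha,\ \alpha-1,\ \alpha+1,\ 3\alpha^2-4,\ 3\alpha^2-1\} \subset \mathbb{Z}[\alpha].$$ Suppose that for every product $h(\alpha)$ of the elements of a nonempty subset of $\Phi$ the rational number $h(\alpha_0)$ is not a square in $\mathbb{Q}$. Then $E_{t_0}$ is an elliptic curve and $\sigma_{t_0}$ is injective. For example, $\sigma_{8/15}$ is injective. -/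

import Mathlib

/-- The curve `y² = x³ - t²x + t²` over a field `F`, for `t ∈ F`. With `F = ℚ(t)` and `t` the
variable it is the curve `E`; with `F = ℚ` and `t = t₀` it is the specialization `E_{t₀}`. -/
def curve {F : Type*} [Field F] (t : F) : WeierstrassCurve.Affine F where
  a₁ := 0
  a₂ := 0
  a₃ := 0
  a₄ := -t ^ 2
  a₆ := t ^ 2

/-- The curve `E : y² = x³ - t²x + t²` over `ℚ(t)`. -/
noncomputable abbrev genericCurve : WeierstrassCurve.Affine (RatFunc ℚ) :=
  curve RatFunc.X

/-- `f ∈ ℚ(t)` has no pole at `t₀` (`RatFunc.denom` is the denominator in lowest terms). -/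
def RegularAt (t₀ : ℚ) (f : RatFunc ℚ) : Prop :=
  f.denom.eval t₀ ≠ 0

/-- The value `f(t₀)` of a rational function, meaningful where `f` has no pole. -/
noncomputable def valueAt (t₀ : ℚ) (f : RatFunc ℚ) : ℚ :=
  RatFunc.eval (RingHom.id ℚ) t₀ f

theorem RegularAt.add {t₀ : ℚ} {f g : RatFunc ℚ} (hf : RegularAt t₀ f) (hg : RegularAt t₀ g) :
    RegularAt t₀ (f + g) := by
  intro h
  have := Polynomial.eval_eq_zero_of_dvd_of_eval_eq_zero (RatFunc.denom_add_dvd f g) h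
  rw [Polynomial.eval_mul] at this
  exact (mul_ne_zero hf hg) this

theorem RegularAt.mul {t₀ : ℚ} {f g : RatFunc ℚ} (hf : RegularAt t₀ f) (hg : RegularAt t₀ g) :
    RegularAt t₀ (f * g) := by
  intro h
  have := Polynomial.eval_eq_zero_of_dvd_of_eval_eq_zero (RatFunc.denom_mul_dvd f g) h
  rw [Polynomial.eval_mul] at this
  exact (mul_ne_zero hf hg) this

theorem regularAt_X (t₀ : ℚ) : RegularAt t₀ RatFunc.X := by
  simp [RegularAt]

theorem valueAt_X (t₀ : ℚ) : valueAt t₀ RatFunc.X = t₀ := by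
  simp [valueAt]

theorem valueAt_add {t₀ : ℚ} {f g : RatFunc ℚ} (hf : RegularAt t₀ f) (hg : RegularAt t₀ g) :
    valueAt t₀ (f + g) = valueAt t₀ f + valueAt t₀ g :=
  RatFunc.eval_add _ _ hf hg

theorem valueAt_mul {t₀ : ℚ} {f g : RatFunc ℚ} (hf : RegularAt t₀ f) (hg : RegularAt t₀ g) :
    valueAt t₀ (f * g) = valueAt t₀ f * valueAt t₀ g :=
  RatFunc.eval_mul _ _ hf hg

/-- If `(x(t), y(t))` lies on `E` and `x`, `y` have no pole at `t₀`, where `E_{t₀}` is an elliptic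
curve, then `(x(t₀), y(t₀))` is a point of `E_{t₀}`. -/
theorem nonsingular_valueAt {t₀ : ℚ} (hΔ : (curve t₀).Δ ≠ 0) {x y : RatFunc ℚ}
    (h : genericCurve.Nonsingular x y) (hx : RegularAt t₀ x) (hy : RegularAt t₀ y) :
    (curve t₀).Nonsingular (valueAt t₀ x) (valueAt t₀ y) := by
  rw [← WeierstrassCurve.Affine.equation_iff_nonsingular_of_Δ_ne_zero hΔ]
  have heq := (WeierstrassCurve.Affine.equation_iff _ _).1 h.1
  rw [WeierstrassCurve.Affine.equation_iff]
  simp only [genericCurve, curve] at heq ⊢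
  have hX := regularAt_X t₀
  have h2 : y * y + RatFunc.X * RatFunc.X * x =
      x * x * x + RatFunc.X * RatFunc.X := by
    linear_combination heq
  have h3 := congrArg (valueAt t₀) h2
  rw [valueAt_add (hy.mul hy) ((hX.mul hX).mul hx), valueAt_mul hy hy,
    valueAt_mul (hX.mul hX) hx, valueAt_mul hX hX,
    valueAt_add ((hx.mul hx).mul hx) (hX.mul hX), valueAt_mul (hx.mul hx) hx,
    valueAt_mul hx hx, valueAt_mul hX hX, valueAt_X] at h3
  linear_combination h3

open scoped Classical in
/-- The specialization map `σ_{t₀} : E(ℚ(t)) → E_{t₀}(ℚ)`, for `t₀` at which `E_{t₀}` is an elliptic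
curve: `(x(t), y(t)) ↦ (x(t₀), y(t₀))` if the coordinates have no pole at `t₀`; the point at infinity
and the points whose coordinates have a pole at `t₀` go to the point at infinity. (On a point of `E`
a pole of one coordinate is a pole of the other.) -/
noncomputable def specialization (t₀ : ℚ) (hΔ : (curve t₀).Δ ≠ 0) :
    genericCurve.Point → (curve t₀).Point
  | .zero => .zero
  | .some x y h =>
    if hxy : RegularAt t₀ x ∧ RegularAt t₀ y then
      .some (valueAt t₀ x) (valueAt t₀ y) (nonsingular_valueAt hΔ h hxy.1 hxy.2)
    else .zero

open Polynomial in
/-- The set `Φ = {-1, α, α - 1, α + 1, 3α² - 4, 3α² - 1}` in `ℤ[α]`. -/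
def Phi : Set (Polynomial ℤ) :=
  {-1, X, X - 1, X + 1, 3 * X ^ 2 - 4, 3 * X ^ 2 - 1}

/-!
The proof is a 2-isogeny descent, run on quartics over `ℚ[α]`.

Put `D = α - α³`. After `t = 1 / D` the cubic `x³ - t²x + t²` acquires the root `αt`, and moving
this root to the origin and clearing denominators turns `E` into `y² = x (x² + a x + b)` with
`a = 3αD`, `b = D² (3α² - 1)`. The 2-isogenous curve has `a = -6αD`, `b = D² (4 - 3α²)`. For both
curves the prime factors of `b` in `ℤ[α]` lie in `Phi`, up to units.

Consider a point whose `x`-coordinate `P / Q` has a pole at `α₀`, that is, a point in the kernel of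
reduction at `α₀`. A prime of `ℤ[α]` not dividing `b` divides `P Q` to an even power
(`even_of_sq_eq_cubic`), so `P Q = h g²` with `h` a product of elements of `Phi`. Dividing the
equation of the curve by `g²` and evaluating at `α₀` shows that `h(α₀)` is a square; hence the
product is empty and `P / Q` is a square (`exists_mul_eq_sq`). So the point has the form
`x = r² / s²` with `z² = r⁴ + a r² s² + b s⁴`, a `KernelTriple`, and it is the image under the
isogeny of a point of the other curve, which may be chosen to reduce to infinity at `α₀` as well
(`KernelTriple.descend`). The new triple satisfies `2 r r' s' = e z' s` for a constant `e`. As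
every kernel triple is itself such an image, `r` is prime to `D`, and then `z'` is prime to `r' s'`.
Therefore `deg r' + deg s' ≤ deg s`, and the descent cannot go on for ever (`not_kernelTriple`).

Thus every affine point of `E` over `ℚ(t)` has coordinates regular at `t₀`
(`regularAt_of_equation`). If two distinct points had the same specialization, their difference
would be an affine point with a pole at `t₀`: regularity of the slope of the corresponding line would
make the common specialization a singular point (`eq_of_valueAt_eq`).

The example is the case `α₀ = -3/2`.
-/

open Polynomial

/-! ### Parity of valuations and square classes in `ℤ[X]` -/

theorem Prime.pow_mul_left_injective {R : Type*} [CommRing R] [IsDomain R] {π u v : R} {m n : ℕ}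
    (hπ : Prime π) (hu : ¬ π ∣ u) (hv : ¬ π ∣ v) (h : π ^ m * u = π ^ n * v) : m = n := by
  wlog hmn : m ≤ n generalizing m n u v
  · exact (this hv hu h.symm (by omega)).symm
  obtain ⟨d, rfl⟩ := Nat.exists_eq_add_of_le hmn
  rw [pow_add, mul_assoc] at h
  have h' := mul_left_cancel₀ (pow_ne_zero m hπ.ne_zero) h
  rcases d with _ | d
  · rfl
  · exact absurd ⟨π ^ d * v, by rw [h']; ring⟩ hu

/-- On `w² = p q (p² + a p q + b q²)`, the curve `y² = x (x² + a x + b)` at `x = p / q`, a prime not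
dividing `b` divides `p q` to an even power. -/
theorem even_of_sq_eq_cubic {R : Type*} [CommRing R] [IsDomain R] [WfDvdMonoid R]
    {a b p q w c π : R} {n : ℕ} (hπ : Prime π) (hb : ¬ π ∣ b) (hp : p ≠ 0) (hq : q ≠ 0)
    (h : w ^ 2 = p * q * (p ^ 2 + a * p * q + b * q ^ 2)) (hn : p * q = π ^ n * c)
    (hc : ¬ π ∣ c) : Even n := by
  obtain ⟨i, p', hp', rfl⟩ := WfDvdMonoid.max_power_factor hp hπ.irreducible
  obtain ⟨j, q', hq', rfl⟩ := WfDvdMonoid.max_power_factor hq hπ.irreducible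
  have hpq : ¬ π ∣ p' * q' := hπ.not_dvd_mul hp' hq'
  have hnij : n = i + j := by
    refine hπ.pow_mul_left_injective hc hpq ?_
    rw [← hn]; ring
  -- If the two valuations differ, the last factor has even valuation.
  have key : ∀ l u, ¬ π ∣ u → w ^ 2 = π ^ (i + j + 2 * l) * u → Even n := by
    intro l u hu hw
    have hw0 : w ≠ 0 := by
      rintro rfl
      have : π ^ (i + j + 2 * l) * u = 0 := by rw [← hw]; ring
      rcases mul_eq_zero.1 this with h0 | h0
      · exact pow_ne_zero _ hπ.ne_zero h0
      · exact hu (h0 ▸ dvd_zero π)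
    obtain ⟨k, w', hw', rfl⟩ := WfDvdMonoid.max_power_factor hw0 hπ.irreducible
    have : 2 * k = i + j + 2 * l :=
      hπ.pow_mul_left_injective (u := w' ^ 2) (fun hd => hw' (hπ.dvd_of_dvd_pow hd)) hu
        (by rw [← hw]; ring)
    exact ⟨k - l, by omega⟩
  rcases lt_trichotomy i j with hij | hij | hij
  · obtain ⟨d, rfl⟩ := Nat.exists_eq_add_of_lt hij
    refine key i (p' * q' * (p' ^ 2 + π * (a * p' * (π ^ d * q') + b * π * (π ^ d * q') ^ 2))) ?_ ?_
    · refine hπ.not_dvd_mul hpq fun hd => hp' (hπ.dvd_of_dvd_pow (n := 2) ?_)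
      exact (dvd_add_left (dvd_mul_right π _)).1 hd
    · rw [h]; ring
  · exact ⟨i, by omega⟩
  · obtain ⟨d, rfl⟩ := Nat.exists_eq_add_of_lt hij
    refine key j (p' * q' * (b * q' ^ 2 + π * (a * (π ^ d * p') * q' + π * (π ^ d * p') ^ 2))) ?_ ?_
    · refine hπ.not_dvd_mul hpq fun hd => ?_
      have := (dvd_add_left (dvd_mul_right π _)).1 hd
      exact hπ.not_dvd_mul hb (fun hd => hq' (hπ.dvd_of_dvd_pow hd)) this
    · rw [h]; ring

/-- If every prime dividing `f` to an odd power is associated to a member of `T`, then `f` is a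
square times a product of distinct elements of `T ∪ {-1}`. The members of `T` have to be normalized
so that they are the primes occurring in `normalizedFactors f`. -/
theorem exists_eq_prod_mul_sq {f : ℤ[X]} (hf : f ≠ 0) {T : Set ℤ[X]}
    (hT : ∀ φ ∈ T, normalize φ = φ)
    (h : ∀ π c n, Prime π → f = π ^ n * c → ¬ π ∣ c → ¬ Even n → ∃ φ ∈ T, Associated π φ) :
    ∃ S : Finset ℤ[X], (S : Set ℤ[X]) ⊆ insert (-1) T ∧ ∃ g, f = (∏ h ∈ S, h) * g ^ 2 := by
  classical
  set m := UniqueFactorizationMonoid.normalizedFactors f with hm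
  obtain ⟨u, hu⟩ := UniqueFactorizationMonoid.prod_normalizedFactors hf
  rw [← hm, Finset.prod_multiset_count] at hu
  set S := m.toFinset.filter fun π => ¬ Even (m.count π) with hS
  set g := ∏ π ∈ m.toFinset, π ^ (m.count π / 2) with hg
  have hprod : ∏ π ∈ m.toFinset, π ^ m.count π = (∏ π ∈ S, π) * g ^ 2 := by
    rw [hS, hg, Finset.prod_filter, ← Finset.prod_pow, ← Finset.prod_mul_distrib]
    refine Finset.prod_congr rfl fun π _ => ?_
    split_ifs with he
    · obtain ⟨k, hk⟩ := he
      rw [hk, show (k + k) / 2 = k by omega]; ring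
    · obtain ⟨k, hk⟩ := Nat.not_even_iff_odd.1 he
      rw [hk, show (2 * k + 1) / 2 = k by omega]; ring
  have hST : (S : Set ℤ[X]) ⊆ T := by
    intro π hπ
    obtain ⟨hπm, hπe⟩ := Finset.mem_filter.1 (Finset.mem_coe.1 hπ)
    rw [Multiset.mem_toFinset] at hπm
    have hp := UniqueFactorizationMonoid.prime_of_normalized_factor π hπm
    have hfin := FiniteMultiplicity.of_prime_left hp hf
    obtain ⟨c, hc, hcd⟩ := hfin.exists_eq_pow_mul_and_not_dvd
    have hcount : m.count π = multiplicity π f := by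
      have := UniqueFactorizationMonoid.emultiplicity_eq_count_normalizedFactors hp.irreducible hf
      rw [UniqueFactorizationMonoid.normalize_normalized_factor π hπm,
        hfin.emultiplicity_eq_multiplicity] at this
      exact_mod_cast this.symm
    rw [← hcount] at hc
    obtain ⟨φ, hφ, ha⟩ := h π c _ hp hc hcd hπe
    have := normalize_eq_normalize ha.dvd ha.symm.dvd
    rw [UniqueFactorizationMonoid.normalize_normalized_factor π hπm, hT φ hφ] at this
    exact this ▸ hφ
  have hunit : (u : ℤ[X]) = 1 ∨ (u : ℤ[X]) = -1 := by
    obtain ⟨r, hr, hru⟩ := Polynomial.isUnit_iff.1 u.isUnit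
    rcases Int.isUnit_iff.1 hr with rfl | rfl
    · left; rw [← hru]; simp
    · right; rw [← hru]; simp
  rcases hunit with h1 | h1
  · exact ⟨S, hST.trans (Set.subset_insert _ _), g, by rw [← hu, hprod, h1, mul_one]⟩
  · refine ⟨insert (-1) S, ?_, g, ?_⟩
    · rw [Finset.coe_insert]; exact Set.insert_subset_insert hST
    · rw [Finset.prod_insert, ← hu, hprod, h1]
      · ring
      · intro hmem
        have := (Finset.mem_filter.1 hmem).1
        rw [Multiset.mem_toFinset] at this
        exact (UniqueFactorizationMonoid.prime_of_normalized_factor _ this).not_isUnit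
          isUnit_one.neg

theorem irreducible_three_mul_sq_sub {c : ℤ} (hc : ¬ IsSquare (3 * c : ℚ)) (hc3 : IsCoprime 3 c) :
    Irreducible (3 * X ^ 2 - C c : ℤ[X]) := by
  have hdeg : (3 * X ^ 2 - C c : ℤ[X]).natDegree = 2 := by
    rw [show (3 : ℤ[X]) = C 3 from rfl]; compute_degree!
  have hprim : (3 * X ^ 2 - C c : ℤ[X]).IsPrimitive := by
    intro r hr
    rw [C_dvd_iff_dvd_coeff] at hr
    have h0 := hr 0
    have h2 := hr 2
    rw [show (3 : ℤ[X]) = C 3 from rfl] at h0 h2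
    simp only [coeff_sub, coeff_C_mul, coeff_X_pow, coeff_C] at h0 h2
    norm_num at h0 h2
    exact hc3.isUnit_of_dvd' h2 h0
  rw [IsPrimitive.Int.irreducible_iff_irreducible_map_cast hprim]
  have hmap : (3 * X ^ 2 - C c : ℤ[X]).map (Int.castRingHom ℚ) = C 3 * X ^ 2 - C (c : ℚ) := by
    simp [show (C 3 : ℚ[X]) = 3 from rfl]
  have hdeg' : (C 3 * X ^ 2 - C (c : ℚ) : ℚ[X]).natDegree = 2 := by compute_degree!
  rw [hmap, Polynomial.irreducible_iff_roots_eq_zero_of_degree_le_three (by omega) (by omega)]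
  refine Multiset.eq_zero_of_forall_notMem fun x hx => hc ⟨3 * x, ?_⟩
  have := (mem_roots'.1 hx).2
  simp [IsRoot] at this
  linear_combination (-3) * this

/-- The members of `Phi` other than the unit `-1`. -/
def phiPrimes : Set ℤ[X] := {X, X - 1, X + 1, 3 * X ^ 2 - 4, 3 * X ^ 2 - 1}

theorem insert_neg_one_phiPrimes : insert (-1) phiPrimes = Phi := rfl

theorem irreducible_of_mem_phiPrimes {φ : ℤ[X]} (h : φ ∈ phiPrimes) : Irreducible φ := by
  rcases h with rfl | rfl | rfl | rfl | rfl
  · exact irreducible_X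
  · simpa using irreducible_X_sub_C (1 : ℤ)
  · simpa using irreducible_X_sub_C (-1 : ℤ)
  · refine irreducible_three_mul_sq_sub (c := 4) ?_ ⟨-1, 1, by norm_num⟩
    norm_num
  · refine irreducible_three_mul_sq_sub (c := 1) ?_ ⟨0, 1, by norm_num⟩
    norm_num

theorem normalize_of_mem_phiPrimes {φ : ℤ[X]} (h : φ ∈ phiPrimes) : normalize φ = φ := by
  have key : ∀ f : ℤ[X], f.leadingCoeff = 1 ∨ f.leadingCoeff = 3 → normalize f = f := by
    intro f hf
    have : normUnit f = 1 := by
      ext1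
      rw [Polynomial.coe_normUnit]
      rcases hf with hf | hf <;> rw [hf] <;> simp [Int.normUnit_eq]
    simp [normalize_apply, this]
  apply key
  rcases h with rfl | rfl | rfl | rfl | rfl
  · simp
  · left; simpa using leadingCoeff_X_sub_C (1 : ℤ)
  · left; simpa using leadingCoeff_X_add_C (1 : ℤ)
  · right
    rw [show (3 * X ^ 2 - 4 : ℤ[X]) = C 3 * X ^ 2 + C (-4) by simp; ring]
    rw [leadingCoeff, show (C 3 * X ^ 2 + C (-4) : ℤ[X]).natDegree = 2 by compute_degree!]
    simp
  · right
    rw [show (3 * X ^ 2 - 1 : ℤ[X]) = C 3 * X ^ 2 + C (-1) by simp; ring]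
    rw [leadingCoeff, show (C 3 * X ^ 2 + C (-1) : ℤ[X]).natDegree = 2 by compute_degree!]
    simp [coeff_one]

/-- No product of a nonempty subset of `Phi` takes a square value at `α₀`. -/
def NonsquareProducts (α₀ : ℚ) : Prop :=
  ∀ S : Finset ℤ[X], (S : Set ℤ[X]) ⊆ Phi → S.Nonempty → ¬ IsSquare (aeval α₀ (∏ h ∈ S, h))

/-- Clearing denominators; stated for all multiples of the denominator `N` so that several polynomials
can be given a common one. -/
theorem exists_intCast_mul_eq_map (P : ℚ[X]) :
    ∃ N : ℤ, N ≠ 0 ∧ ∀ M : ℤ, N ∣ M →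
      ∃ p : ℤ[X], p.map (Int.castRingHom ℚ) = C (M : ℚ) * P := by
  obtain ⟨N, hN, h⟩ := IsLocalization.integerNormalization_spec (nonZeroDivisors ℤ) P
  refine ⟨N, nonZeroDivisors.ne_zero hN, ?_⟩
  rintro _ ⟨M, rfl⟩
  refine ⟨C M * IsLocalization.integerNormalization (nonZeroDivisors ℤ) P, ?_⟩
  rw [algebraMap_int_eq] at h
  rw [Polynomial.map_mul, h, map_C, zsmul_eq_mul]
  simp
  ring

/-- If `P / Q` is the `x`-coordinate of a point of `y² = x (x² + a x + b)` with a pole at `α₀`, and the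
primes dividing `b` lie in `phiPrimes`, then `P / Q` is a square. -/
theorem exists_mul_eq_sq {α₀ : ℚ} (h0 : NonsquareProducts α₀) {a b : ℤ[X]}
    (hb : ∀ π, Prime π → π ∣ b → ∃ φ ∈ phiPrimes, Associated π φ) {P Q W : ℚ[X]}
    (hP : P.eval α₀ ≠ 0) (hQ : Q ≠ 0) (hQ0 : Q.eval α₀ = 0)
    (h : W ^ 2 = P * Q * (P ^ 2 + a.map (Int.castRingHom ℚ) * P * Q +
      b.map (Int.castRingHom ℚ) * Q ^ 2)) :
    ∃ g, P * Q = g ^ 2 := by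
  obtain ⟨N₁, hN₁, h₁⟩ := exists_intCast_mul_eq_map P
  obtain ⟨N₂, hN₂, h₂⟩ := exists_intCast_mul_eq_map Q
  obtain ⟨N₃, hN₃, h₃⟩ := exists_intCast_mul_eq_map W
  set N := N₁ * N₂ * N₃ with hN
  have hN0 : (N : ℚ) ≠ 0 :=
    Int.cast_ne_zero.2 (mul_ne_zero (mul_ne_zero hN₁ hN₂) hN₃)
  obtain ⟨p, hp⟩ := h₁ N ⟨N₂ * N₃, by rw [hN]; ring⟩
  obtain ⟨q, hq⟩ := h₂ N ⟨N₁ * N₃, by rw [hN]; ring⟩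
  obtain ⟨w, hw⟩ := h₃ N ⟨N₁ * N₂, by rw [hN]; ring⟩
  have hinj : Function.Injective (Polynomial.map (Int.castRingHom ℚ)) :=
    map_injective _ Int.cast_injective
  have hCN : (C (N : ℚ)) ≠ 0 := C_ne_zero.2 hN0
  have hP0 : P ≠ 0 := by rintro rfl; simp at hP
  have hp0 : p ≠ 0 := by
    rintro rfl
    exact mul_ne_zero hCN hP0 (by rw [← hp]; simp)
  have hq0 : q ≠ 0 := by
    rintro rfl
    exact mul_ne_zero hCN hQ (by rw [← hq]; simp)
  have heq : ((N : ℤ[X]) * w) ^ 2 = p * q * (p ^ 2 + a * p * q + b * q ^ 2) := by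
    apply hinj
    simp only [Polynomial.map_mul, Polynomial.map_pow, Polynomial.map_add, hp, hq, hw,
      Polynomial.map_intCast]
    rw [show ((N : ℚ[X])) = C (N : ℚ) by simp]
    linear_combination (C (N : ℚ)) ^ 4 * h
  obtain ⟨S, hS, g, hg⟩ := exists_eq_prod_mul_sq (mul_ne_zero hp0 hq0)
    (fun φ hφ => normalize_of_mem_phiPrimes hφ) fun π c n hπ hn hc hodd =>
      hb π hπ (by_contra fun hπb => hodd (even_of_sq_eq_cubic hπ hπb hp0 hq0 heq hn hc))
  rw [insert_neg_one_phiPrimes] at hS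
  rcases S.eq_empty_or_nonempty with rfl | hne
  · refine ⟨C (N : ℚ)⁻¹ * g.map (Int.castRingHom ℚ), ?_⟩
    have := congrArg (Polynomial.map (Int.castRingHom ℚ)) hg
    simp only [Finset.prod_empty, one_mul, Polynomial.map_mul, Polynomial.map_pow, hp, hq] at this
    have hinv : C (N : ℚ)⁻¹ * C (N : ℚ) = 1 := by rw [← C_mul, inv_mul_cancel₀ hN0, C_1]
    linear_combination (C (N : ℚ)⁻¹) ^ 2 * this - P * Q * (C (N : ℚ)⁻¹ * C (N : ℚ) + 1) * hinv
  -- Otherwise the squarefree part of `p * q` would take a square value at `α₀`.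
  · exfalso
    apply h0 S hS hne
    have hg0 : g ≠ 0 := by
      rintro rfl
      exact mul_ne_zero hp0 hq0 (by rw [hg]; ring)
    -- Divide the equation by `g ^ 2` and evaluate at the root `α₀` of `q`.
    obtain ⟨v, hv⟩ : g ∣ (N : ℤ[X]) * w := by
      rw [← IsIntegrallyClosed.pow_dvd_pow_iff two_ne_zero, heq, hg]
      exact ⟨(∏ h ∈ S, h) * (p ^ 2 + a * p * q + b * q ^ 2), by ring⟩
    have hv2 : v ^ 2 = (∏ h ∈ S, h) * (p ^ 2 + a * p * q + b * q ^ 2) := by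
      apply mul_left_cancel₀ (pow_ne_zero 2 hg0)
      rw [← mul_pow, ← hv, heq, hg]; ring
    have hev : ∀ f : ℤ[X], aeval α₀ f = (f.map (Int.castRingHom ℚ)).eval α₀ := by
      intro f; rw [← algebraMap_int_eq, eval_map_algebraMap]
    have hq1 : aeval α₀ q = 0 := by rw [hev, hq, eval_mul, hQ0, mul_zero]
    have hp1 : aeval α₀ p ≠ 0 := by rw [hev, hp, eval_mul, eval_C]; exact mul_ne_zero hN0 hP
    have := congrArg (aeval α₀) hv2
    simp only [map_mul, map_pow, map_add, hq1] at this
    refine ⟨aeval α₀ v / aeval α₀ p, ?_⟩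
    field_simp
    linear_combination -this

/-! ### The two isogenous curves over `ℚ(α)` -/

/-- The linear coefficient of the curve over `ℚ(α)`, divided by `D = X - X ^ 3`. The index `false`
stands for the curve `E` with its point `(αt, 0)` moved to the origin and its equation multiplied
by `D ^ 6`, the index `true` for the 2-isogenous curve. -/
noncomputable def fibreA : Bool → ℤ[X]
  | false => 3 * X
  | true => -6 * X

/-- The constant coefficient of the curve over `ℚ(α)`, divided by `(X - X ^ 3) ^ 2`. -/
noncomputable def fibreB : Bool → ℤ[X]
  | false => 3 * X ^ 2 - 1
  | true => 4 - 3 * X ^ 2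

/-- The coefficient `a` of the curve `y² = x (x² + a x + b)` with index `i`. -/
noncomputable def linearCoeff (i : Bool) : ℚ[X] :=
  (X - X ^ 3) * (fibreA i).map (Int.castRingHom ℚ)

/-- The coefficient `b` of the curve `y² = x (x² + a x + b)` with index `i`. -/
noncomputable def constCoeff (i : Bool) : ℚ[X] :=
  (X - X ^ 3) ^ 2 * (fibreB i).map (Int.castRingHom ℚ)

/-- The isogenous curve of `y² = x (x² + a x + b)` is `y² = x (x² - 2 a x + a² - 4 b)`. Applied twice
this gives `4 a` and `16 b`, so returning to the first curve takes the rescaling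
`x ↦ dualScale i ^ 2 * x`. -/
def dualScale : Bool → ℚ
  | false => 1
  | true => 2

theorem C_rat_two : (C 2 : ℚ[X]) = 2 := rfl

theorem linearCoeff_not (i : Bool) :
    C (dualScale i) ^ 2 * linearCoeff (!i) = -2 * linearCoeff i := by
  cases i <;> simp [linearCoeff, fibreA, dualScale, C_rat_two] <;> ring

theorem constCoeff_not (i : Bool) :
    C (dualScale i) ^ 4 * constCoeff (!i) = linearCoeff i ^ 2 - 4 * constCoeff i := by
  cases i <;> simp [linearCoeff, constCoeff, fibreA, fibreB, dualScale, C_rat_two] <;> ring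

theorem dualScale_ne_zero (i : Bool) : dualScale i ≠ 0 := by cases i <;> simp [dualScale]

theorem squarefree_X_sub_X_pow : Squarefree (X - X ^ 3 : ℚ[X]) := by
  refine Polynomial.Separable.squarefree ⟨C (9 / 2) * X, 1 - C (3 / 2) * X ^ 2, ?_⟩
  have h : (C (9 / 2) : ℚ[X]) = 3 * C (3 / 2) := by
    rw [show (3 : ℚ[X]) = C 3 from rfl, ← C_mul]; norm_num
  have h2 : (2 : ℚ[X]) * C (3 / 2) = 3 := by
    rw [show (3 : ℚ[X]) = C 3 from rfl, ← C_rat_two, ← C_mul]; norm_num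
  simp only [derivative_sub, derivative_X, derivative_X_pow, h]
  simp [show (C 3 : ℚ[X]) = 3 from rfl]
  linear_combination X ^ 2 * h2

theorem squarefree_fibreB (i : Bool) :
    Squarefree ((fibreB i).map (Int.castRingHom ℚ)) := by
  cases i
  · refine Polynomial.Separable.squarefree ⟨-1, C (1 / 2) * X, ?_⟩
    have h2 : (2 : ℚ[X]) * C (1 / 2) = 1 := by
      rw [← C_rat_two, ← C_mul]; norm_num
    simp [fibreB] at h2 ⊢
    linear_combination 3 * X ^ 2 * h2
  · refine Polynomial.Separable.squarefree ⟨C (1 / 4), - C (1 / 8) * X, ?_⟩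
    have h2 : (8 : ℚ[X]) * C (1 / 8) = 1 := by
      rw [show (8 : ℚ[X]) = C 8 from rfl, ← C_mul]; norm_num
    have h : (C (1 / 4) : ℚ[X]) = 2 * C (1 / 8) := by
      rw [← C_rat_two, ← C_mul]; norm_num
    rw [h]
    simp [fibreB] at h2 ⊢
    linear_combination h2

theorem isCoprime_fibreB (i : Bool) :
    IsCoprime ((fibreB i).map (Int.castRingHom ℚ)) (X - X ^ 3) := by
  have h2 : (4 : ℚ[X]) * C (1 / 4) = 1 := by
    rw [show (4 : ℚ[X]) = C 4 from rfl, ← C_mul]; norm_num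
  cases i
  · refine ⟨-1 + 6 * C (1 / 4) * X ^ 2, 18 * C (1 / 4) * X, ?_⟩
    simp [fibreB] at h2 ⊢
    linear_combination 3 * X ^ 2 * h2
  · refine ⟨C (1 / 4) + 3 * C (1 / 4) * X ^ 2, - 9 * C (1 / 4) * X, ?_⟩
    simp [fibreB] at h2 ⊢
    linear_combination h2

theorem associated_of_prime_dvd_constCoeff (i : Bool) {π : ℤ[X]} (hπ : Prime π)
    (h : π ∣ (X - X ^ 3) ^ 2 * fibreB i) : ∃ φ ∈ phiPrimes, Associated π φ := by
  have key : ∃ φ ∈ phiPrimes, π ∣ φ := by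
    rcases hπ.dvd_or_dvd h with h | h
    · have h' := hπ.dvd_of_dvd_pow h
      rw [show (X - X ^ 3 : ℤ[X]) = X * (X - 1) * (-(X + 1)) by ring] at h'
      rcases hπ.dvd_or_dvd h' with h | h
      · rcases hπ.dvd_or_dvd h with h | h
        · exact ⟨X, by simp [phiPrimes], h⟩
        · exact ⟨X - 1, by simp [phiPrimes], h⟩
      · exact ⟨X + 1, by simp [phiPrimes], (dvd_neg.1 h)⟩
    · cases i
      · exact ⟨fibreB false, by simp [phiPrimes, fibreB], h⟩
      · refine ⟨3 * X ^ 2 - 4, by simp [phiPrimes], dvd_neg.1 ?_⟩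
        rwa [neg_sub]
  obtain ⟨φ, hφ, hd⟩ := key
  exact ⟨φ, hφ, hπ.irreducible.associated_of_dvd (irreducible_of_mem_phiPrimes hφ) hd⟩

/-! ### Kernel triples and the descent step -/

/-- A point `x = r² / s²`, `y = r z / s³` in lowest terms on the curve with index `i`, with a pole
at `α₀`. -/
structure KernelTriple (α₀ : ℚ) (i : Bool) (r s z : ℚ[X]) : Prop where
  isCoprime : IsCoprime r s
  ne_zero : s ≠ 0
  eval_eq_zero : s.eval α₀ = 0
  equation : z ^ 2 = r ^ 4 + linearCoeff i * r ^ 2 * s ^ 2 + constCoeff i * s ^ 4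

theorem KernelTriple.eval_left_ne_zero {α₀ : ℚ} {i : Bool} {r s z : ℚ[X]}
    (h : KernelTriple α₀ i r s z) : r.eval α₀ ≠ 0 := by
  intro h0
  obtain ⟨u, v, huv⟩ := h.isCoprime
  have := congrArg (eval α₀) huv
  simp [h0, h.eval_eq_zero] at this

theorem KernelTriple.left_ne_zero {α₀ : ℚ} {i : Bool} {r s z : ℚ[X]}
    (h : KernelTriple α₀ i r s z) : r ≠ 0 := by
  rintro rfl
  exact h.eval_left_ne_zero (by simp)

/-- Every point with a pole at `α₀` comes from a kernel triple. The common factor `k` is recorded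
because the descent step compares the two representations of one point. -/
theorem exists_kernelTriple {α₀ : ℚ} (h0 : NonsquareProducts α₀) (i : Bool) {P Q W : ℚ[X]}
    (hP : P.eval α₀ ≠ 0) (hQ : Q ≠ 0) (hQ0 : Q.eval α₀ = 0)
    (h : W ^ 2 = P * Q * (P ^ 2 + linearCoeff i * P * Q + constCoeff i * Q ^ 2)) :
    ∃ k r s z, KernelTriple α₀ i r s z ∧ P = k * r ^ 2 ∧ Q = k * s ^ 2 ∧
      W = k ^ 2 * r * s * z := by
  have hmapD : (X - X ^ 3 : ℚ[X]) = (X - X ^ 3 : ℤ[X]).map (Int.castRingHom ℚ) := by simp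
  obtain ⟨g, hg⟩ := exists_mul_eq_sq (W := W) h0
    (fun π hπ hd => associated_of_prime_dvd_constCoeff i hπ hd) hP hQ hQ0
    (a := (X - X ^ 3) * fibreA i) (by
      rw [h, linearCoeff, constCoeff, Polynomial.map_mul, Polynomial.map_mul, Polynomial.map_pow,
        ← hmapD])
  classical
  set d := EuclideanDomain.gcd g Q with hd
  obtain ⟨r, hr⟩ := EuclideanDomain.gcd_dvd_left g Q
  obtain ⟨s, hs⟩ := EuclideanDomain.gcd_dvd_right g Q
  rw [← hd] at hr hs
  have hd0 : d ≠ 0 := by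
    intro h'
    exact hQ (by rw [hs, h', zero_mul])
  have hcop : IsCoprime r s := by
    refine ⟨EuclideanDomain.gcdA g Q, EuclideanDomain.gcdB g Q, mul_left_cancel₀ hd0 ?_⟩
    linear_combination -EuclideanDomain.gcd_eq_gcd_ab g Q - EuclideanDomain.gcdA g Q * hr -
      EuclideanDomain.gcdB g Q * hs
  -- From `P * s = d * r ^ 2` and coprimality, `s` divides `d`.
  have hPs : P * s = d * r ^ 2 := by
    apply mul_left_cancel₀ hd0
    linear_combination hg - P * hs + (g + d * r) * hr
  obtain ⟨k, hk⟩ : s ∣ d :=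
    (hcop.symm.pow_right (n := 2)).dvd_of_dvd_mul_right ⟨P, by rw [← hPs]; ring⟩
  have hs0 : s ≠ 0 := by
    rintro rfl
    exact hQ (by rw [hs, mul_zero])
  have hPk : P = k * r ^ 2 := by
    apply mul_left_cancel₀ hs0
    linear_combination hPs + r ^ 2 * hk
  have hQk : Q = k * s ^ 2 := by rw [hs, hk]; ring
  have hk0 : k.eval α₀ ≠ 0 ∧ r.eval α₀ ≠ 0 := by
    rw [hPk] at hP
    simpa [not_or] using hP
  have hsr : s.eval α₀ = 0 := by
    rw [hQk] at hQ0
    simpa [hk0.1] using hQ0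
  have hfac : k ^ 2 * r * s ≠ 0 := by
    refine mul_ne_zero (mul_ne_zero (pow_ne_zero 2 ?_) ?_) hs0
    · rintro rfl; simp at hk0
    · rintro rfl; simp at hk0
  have hW : W ^ 2 = (k ^ 2 * r * s) ^ 2 *
      (r ^ 4 + linearCoeff i * r ^ 2 * s ^ 2 + constCoeff i * s ^ 4) := by
    rw [h, hPk, hQk]; ring
  obtain ⟨z, hz⟩ : k ^ 2 * r * s ∣ W := by
    rw [← IsIntegrallyClosed.pow_dvd_pow_iff two_ne_zero, hW]
    exact dvd_mul_right _ _
  refine ⟨k, r, s, z, ⟨hcop, hs0, hsr, ?_⟩, hPk, hQk, hz⟩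
  apply mul_left_cancel₀ (pow_ne_zero 2 hfac)
  rw [← hW, hz]; ring

/-- A kernel triple lifts through the isogeny to a kernel triple on the other curve. The final equation
is the isogeny `x = y'² / (4 x'²)` (up to scaling) after extracting square roots. -/
theorem KernelTriple.descend {α₀ : ℚ} (h0 : NonsquareProducts α₀) {i : Bool} {r s z : ℚ[X]}
    (h : KernelTriple α₀ i r s z) :
    ∃ r' s' z', KernelTriple α₀ (!i) r' s' z' ∧
      2 * r * r' * s' = C (dualScale i) * z' * s := by
  -- At `α₀` the equation reads `z² = r⁴`. The two lifts differ by the sign of `z`; the sign with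
  -- `z = r²` at `α₀` gives the lift that has a pole there.
  wlog hz : z.eval α₀ = r.eval α₀ ^ 2 generalizing z
  · refine this (z := -z) ⟨h.isCoprime, h.ne_zero, h.eval_eq_zero, by rw [neg_sq, h.equation]⟩ ?_
    have := congrArg (eval α₀) h.equation
    simp only [eval_add, eval_mul, eval_pow, h.eval_eq_zero] at this
    have h2 : (z.eval α₀ - r.eval α₀ ^ 2) * (z.eval α₀ + r.eval α₀ ^ 2) = 0 := by
      linear_combination this
    rw [eval_neg]
    linarith [(mul_eq_zero.1 h2).resolve_left (sub_ne_zero.2 hz)]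
  set e : ℚ[X] := C (dualScale i) with he
  have he0 : e ≠ 0 := C_ne_zero.2 (dualScale_ne_zero i)
  set P : ℚ[X] := 2 * r ^ 2 + linearCoeff i * s ^ 2 + 2 * z with hP
  have ha := linearCoeff_not i
  have hb := constCoeff_not i
  rw [← he] at ha hb
  have hP0 : P.eval α₀ ≠ 0 := by
    have : P.eval α₀ = 4 * r.eval α₀ ^ 2 := by
      simp [hP, hz, h.eval_eq_zero]; ring
    rw [this]
    exact mul_ne_zero four_ne_zero (pow_ne_zero 2 h.eval_left_ne_zero)
  obtain ⟨k, r', s', z', h', hPk, hQk, hW⟩ :=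
    -- The `x`-coordinate of the lift is `P / (e² s²)`.
    exists_kernelTriple h0 (!i) (P := P) (Q := e ^ 2 * s ^ 2) (W := 2 * e * r * s * P) hP0
      (mul_ne_zero (pow_ne_zero 2 he0) (pow_ne_zero 2 h.ne_zero))
      (by simp [h.eval_eq_zero]) (by
        linear_combination (-P * e ^ 2 * s ^ 4 * P) * ha - P * e ^ 2 * s ^ 6 * hb -
          P * e ^ 2 * s ^ 2 * 4 * h.equation)
  refine ⟨r', s', z', h', ?_⟩
  have hk0 : k ≠ 0 := by
    rintro rfl
    exact hP0 (by rw [hPk]; simp)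
  have h1 : 2 * e * r * s * r' = k * s' * z' := by
    apply mul_left_cancel₀ (mul_ne_zero hk0 h'.left_ne_zero)
    linear_combination hW - 2 * e * r * s * hPk
  apply mul_left_cancel₀ (mul_ne_zero he0 h.ne_zero)
  linear_combination s' * h1 - z' * hQk

/-! ### Termination of the descent -/

theorem KernelTriple.not_dvd_right {α₀ : ℚ} {i : Bool} {r s z : ℚ[X]}
    (h : KernelTriple α₀ i r s z) {π : ℚ[X]} (hπ : Prime π) (hr : π ∣ r) : ¬ π ∣ s :=
  fun hs => hπ.not_isUnit (h.isCoprime.isUnit_of_dvd' hr hs)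

/-- This holds because the triple is an image under the isogeny: for a prime `π` dividing `r` and
`X - X ^ 3`, the lift has `z'` divisible by `π` exactly once and `r'` divisible by `π`, which
contradicts `2 r r' s' = e z' s`. -/
theorem KernelTriple.isCoprime_left {α₀ : ℚ} (h0 : NonsquareProducts α₀) {i : Bool}
    {r s z : ℚ[X]} (h : KernelTriple α₀ i r s z) : IsCoprime r (X - X ^ 3) := by
  obtain ⟨r', s', z', h', hrel⟩ := h.descend h0
  have hC : IsUnit (C (dualScale i)) := isUnit_C.2 (dualScale_ne_zero i).isUnit
  refine isCoprime_of_prime_dvd (fun hh => h.left_ne_zero hh.1) fun π hπ hπr hπD => ?_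
  have hπs := h.not_dvd_right hπ hπr
  have hπC : ¬ π ∣ C (dualScale i) := fun hd => hπ.not_isUnit (isUnit_of_dvd_unit hd hC)
  have heq := h'.equation
  obtain ⟨d, hd⟩ := hπD
  simp only [linearCoeff, constCoeff, hd] at heq
  set A := (fibreA !i).map (Int.castRingHom ℚ)
  set B := (fibreB !i).map (Int.castRingHom ℚ)
  have hπB : ¬ π ∣ B := fun hB' => hπ.not_isUnit
    ((isCoprime_fibreB (!i)).isUnit_of_dvd' hB' ⟨d, hd⟩)
  have hπd : ¬ π ∣ d := by
    rintro ⟨d', rfl⟩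
    exact hπ.not_isUnit (squarefree_X_sub_X_pow π ⟨d', by rw [hd]; ring⟩)
  have hz : π ∣ z' := by
    have h1 : π ∣ C (dualScale i) * z' * s := by
      rw [← hrel]
      exact ((hπr.mul_left 2).mul_right r').mul_right s'
    rcases hπ.dvd_or_dvd h1 with h2 | h2
    · exact (hπ.dvd_or_dvd h2).resolve_left hπC
    · exact absurd h2 hπs
  have hr' : π ∣ r' := by
    refine hπ.dvd_of_dvd_pow (n := 4) ?_
    have : r' ^ 4 = z' ^ 2 - π * (d * A * r' ^ 2 * s' ^ 2 + π * d ^ 2 * B * s' ^ 4) := by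
      rw [heq]; ring
    rw [this]
    exact dvd_sub (dvd_pow hz two_ne_zero) (dvd_mul_right _ _)
  have hs' := h'.not_dvd_right hπ hr'
  obtain ⟨ρ, rfl⟩ := hπr
  obtain ⟨r₁, rfl⟩ := hr'
  obtain ⟨z₁, rfl⟩ := hz
  have hz1 : π ∣ z₁ := by
    have h1 : π ∣ C (dualScale i) * z₁ * s := by
      refine ⟨2 * ρ * r₁ * s', mul_left_cancel₀ hπ.ne_zero ?_⟩
      linear_combination -hrel
    rcases hπ.dvd_or_dvd h1 with h2 | h2
    · exact (hπ.dvd_or_dvd h2).resolve_left hπC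
    · exact absurd h2 hπs
  have : π ∣ d ^ 2 * B * s' ^ 4 := by
    have h1 : d ^ 2 * B * s' ^ 4 =
        z₁ ^ 2 - π * (π * r₁ ^ 4 + d * A * r₁ ^ 2 * s' ^ 2) := by
      apply mul_left_cancel₀ (pow_ne_zero 2 hπ.ne_zero)
      linear_combination -heq
    rw [h1]
    exact dvd_sub (dvd_pow hz1 two_ne_zero) (dvd_mul_right _ _)
  rcases hπ.dvd_or_dvd this with h2 | h2
  · rcases hπ.dvd_or_dvd h2 with h3 | h3
    · exact hπd (hπ.dvd_of_dvd_pow h3)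
    · exact hπB h3
  · exact hs' (hπ.dvd_of_dvd_pow h2)

theorem KernelTriple.isCoprime_mul {α₀ : ℚ} (h0 : NonsquareProducts α₀) {i : Bool}
    {r s z : ℚ[X]} (h : KernelTriple α₀ i r s z) : IsCoprime z (r * s) := by
  have heq := h.equation
  refine IsCoprime.mul_right ?_ ?_
  · refine isCoprime_of_prime_dvd (fun hh => h.left_ne_zero hh.2) fun π hπ hπz hπr => ?_
    have hπs := h.not_dvd_right hπ hπr
    have hπD : ¬ π ∣ X - X ^ 3 := fun hd =>
      hπ.not_isUnit ((h.isCoprime_left h0).isUnit_of_dvd' hπr hd)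
    obtain ⟨r₁, rfl⟩ := hπr
    obtain ⟨z₁, rfl⟩ := hπz
    have hdvd : π ^ 2 ∣ ((X - X ^ 3) ^ 2 * s ^ 4) * (fibreB i).map (Int.castRingHom ℚ) := by
      refine ⟨z₁ ^ 2 - π ^ 2 * r₁ ^ 4 - linearCoeff i * r₁ ^ 2 * s ^ 2, ?_⟩
      rw [constCoeff] at heq
      linear_combination -heq
    have hn : ¬ π ∣ (X - X ^ 3) ^ 2 * s ^ 4 :=
      hπ.not_dvd_mul (fun hd => hπD (hπ.dvd_of_dvd_pow hd)) fun hd => hπs (hπ.dvd_of_dvd_pow hd)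
    have := hπ.pow_dvd_of_dvd_mul_left 2 hn hdvd
    exact hπ.not_isUnit (squarefree_fibreB i π (by rwa [← sq]))
  · have h4 : IsCoprime (z ^ 2) s := by
      rw [heq, show r ^ 4 + linearCoeff i * r ^ 2 * s ^ 2 + constCoeff i * s ^ 4 =
        r ^ 4 + s * (linearCoeff i * r ^ 2 * s + constCoeff i * s ^ 3) by ring]
      exact (h.isCoprime.pow_left).add_mul_left_left _
    exact (IsCoprime.pow_left_iff two_pos).1 h4

/-- Were `r` and `z` both constant, comparison with the value at the root `α₀` of `s` would give
`a r² + b s² = 0`; divided by `X - X ^ 3`, this forces `r = 0` at the point `1`. -/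
theorem KernelTriple.natDegree_pos {α₀ : ℚ} {i : Bool} {r s z : ℚ[X]}
    (h : KernelTriple α₀ i r s z) (hr : r.natDegree = 0) : 0 < z.natDegree := by
  by_contra! hz
  have heq := h.equation
  rw [eq_C_of_natDegree_eq_zero hr] at heq
  rw [eq_C_of_natDegree_le_zero hz] at heq
  set c := r.coeff 0
  set w := z.coeff 0
  have hc : c ≠ 0 := by
    intro hc
    apply h.left_ne_zero
    rw [eq_C_of_natDegree_eq_zero hr]
    simpa using hc
  have hconst : w ^ 2 = c ^ 4 := by
    have := congrArg (eval α₀) heq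
    simpa [h.eval_eq_zero] using this
  have hwc : (C w : ℚ[X]) ^ 2 = C c ^ 4 := by rw [← C_pow, ← C_pow, hconst]
  have hfac : (X - X ^ 3) * ((fibreA i).map (Int.castRingHom ℚ) * C c ^ 2 +
      (X - X ^ 3) * (fibreB i).map (Int.castRingHom ℚ) * s ^ 2) = 0 := by
    apply mul_left_cancel₀ (pow_ne_zero 2 h.ne_zero)
    rw [linearCoeff, constCoeff] at heq
    linear_combination hwc - heq
  have hA := (mul_eq_zero.1 hfac).resolve_left squarefree_X_sub_X_pow.ne_zero
  have := congrArg (eval 1) hA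
  cases i <;> simp [fibreA, hc] at this

/-- There are no kernel triples: the descent step lowers `deg s`, unless `r'` is constant, in which
case `r` is not. The measure `2 deg s + min 1 (deg r)` decreases in both cases. -/
theorem not_kernelTriple {α₀ : ℚ} (h0 : NonsquareProducts α₀) {i : Bool} {r s z : ℚ[X]} :
    ¬ KernelTriple α₀ i r s z := by
  induction hn : 2 * s.natDegree + min 1 r.natDegree using Nat.strong_induction_on
    generalizing i r s z with
  | _ n ih =>
    intro h
    obtain ⟨r', s', z', h', hrel⟩ := h.descend h0
    have hcop := h'.isCoprime_mul h0
    have hC : IsUnit (C (dualScale i)) := isUnit_C.2 (dualScale_ne_zero i).isUnit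
    have h2 : IsUnit (2 : ℚ[X]) := isUnit_C.2 (two_ne_zero (α := ℚ)).isUnit
    have hdeg : r'.natDegree + s'.natDegree ≤ s.natDegree := by
      rw [← natDegree_mul h'.left_ne_zero h'.ne_zero]
      refine natDegree_le_of_dvd (hcop.symm.dvd_of_dvd_mul_left (hC.dvd_mul_left.1 ?_)) h.ne_zero
      exact ⟨2 * r, by linear_combination -hrel⟩
    have hdeg' : z'.natDegree ≤ r.natDegree := by
      refine natDegree_le_of_dvd (h2.dvd_mul_left.1 (hcop.dvd_of_dvd_mul_right ?_)) h.left_ne_zero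
      exact ⟨C (dualScale i) * s, by linear_combination hrel⟩
    refine ih _ ?_ rfl h'
    by_cases hr' : r'.natDegree = 0
    · have := h'.natDegree_pos hr'
      omega
    · omega

/-! ### Pullback along `t = 1 / (α - α³)` -/

theorem NonsquareProducts.sub_pow_ne_zero {α₀ : ℚ} (h0 : NonsquareProducts α₀) :
    α₀ - α₀ ^ 3 ≠ 0 := by
  have key : ∀ φ ∈ Phi, aeval α₀ φ ≠ 0 := by
    intro φ hφ hz
    refine h0 {φ} (by simpa using hφ) (Finset.singleton_nonempty φ) ?_
    rw [Finset.prod_singleton, hz]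
    exact IsSquare.zero
  have h1 := key X (by simp [Phi])
  have h2 := key (X - 1) (by simp [Phi])
  have h3 := key (X + 1) (by simp [Phi])
  simp at h1 h2 h3
  intro h
  have : α₀ * ((α₀ - 1) * (α₀ + 1)) = 0 := by linear_combination -h
  simp [h1, h2, h3] at this

/-- The polynomial `D ^ N * f(1 / D)`, where `D = X - X ^ 3` and `N` is at least the degree of `f`. -/
noncomputable def pullback (N : ℕ) (f : ℚ[X]) : ℚ[X] := (f.reflect N).comp (X - X ^ 3)

theorem eval_pullback {N : ℕ} {f : ℚ[X]} (hf : f.natDegree ≤ N) {β : ℚ} (hβ : β - β ^ 3 ≠ 0) :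
    (pullback N f).eval β = (β - β ^ 3) ^ N * f.eval (β - β ^ 3)⁻¹ := by
  have hu : ((β - β ^ 3)⁻¹) ≠ 0 := inv_ne_zero hβ
  let := invertibleOfNonzero hu
  have := eval₂_reflect_mul_pow (RingHom.id ℚ) (β - β ^ 3)⁻¹ N f hf
  rw [invOf_eq_inv, inv_inv] at this
  simp only [pullback, eval_comp, eval_sub, eval_X, eval_pow]
  rw [← eval₂_id, ← eval₂_id, ← this, mul_left_comm, ← mul_pow, mul_inv_cancel₀ hβ, one_pow,
    mul_one]

theorem pullback_ne_zero {N : ℕ} {f : ℚ[X]} (hf : f ≠ 0) : pullback N f ≠ 0 := by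
  intro h
  rcases comp_eq_zero_iff.1 h with h | h
  · exact hf (reflect_eq_zero_iff.1 h)
  · apply squarefree_X_sub_X_pow.ne_zero
    rw [h.2]; simp

/-- The substitution `t = 1 / D`, with `D = X - X ^ 3`, takes the point of `E` with `x = u / v` and
`y = m / v²` to the point with `x`-coordinate `D² (u / v - α / D)` on the curve with index
`false`. -/
theorem pullback_equation {u v m : ℚ[X]}
    (h : m ^ 2 = v * (u ^ 3 - X ^ 2 * u * v ^ 2 + X ^ 2 * v ^ 3)) {n : ℕ}
    (hu : u.natDegree ≤ n) (hv : v.natDegree ≤ n) (hm : m.natDegree ≤ 2 * n)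
    {P Q : ℚ[X]} (hP : P = (X - X ^ 3) ^ 2 * pullback n u - X * (X - X ^ 3) * pullback n v)
    (hQ : Q = pullback n v) :
    ((X - X ^ 3) ^ 3 * pullback (2 * n) m) ^ 2 =
      P * Q * (P ^ 2 + linearCoeff false * P * Q + constCoeff false * Q ^ 2) := by
  apply mul_left_cancel₀ squarefree_X_sub_X_pow.ne_zero
  -- The values at all `β` are compared; the factor `X - X ^ 3` disposes of the poles of `1 / D`.
  refine Polynomial.funext fun β => ?_
  by_cases hβ : β - β ^ 3 = 0
  · simp [hβ]
  have hmβ := congrArg (eval (β - β ^ 3)⁻¹) h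
  simp only [hP, hQ, linearCoeff, constCoeff, fibreA, fibreB, eval_mul, eval_pow, eval_sub, eval_X,
    eval_add, eval_pullback hu hβ, eval_pullback hv hβ, eval_pullback hm hβ, Polynomial.map_mul,
    Polynomial.map_sub, Polynomial.map_pow, map_X, Polynomial.map_ofNat, eval_ofNat,
    Polynomial.map_one, eval_one] at hmβ ⊢
  generalize eval (β - β ^ 3)⁻¹ u = u₀ at *
  generalize eval (β - β ^ 3)⁻¹ v = v₀ at *
  generalize eval (β - β ^ 3)⁻¹ m = m₀ at *
  obtain ⟨d, hd⟩ : ∃ d, d = β - β ^ 3 := ⟨_, rfl⟩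
  rw [← hd] at hβ hmβ ⊢
  have h6 : d ^ 6 * m₀ ^ 2 = v₀ * d ^ 3 * (d ^ 3 * u₀ ^ 3 - d * u₀ * v₀ ^ 2 + d * v₀ ^ 3) := by
    rw [hmβ]; field_simp
  rw [pow_mul']
  generalize d ^ n = D
  linear_combination d * D ^ 4 * h6 + d ^ 4 * D ^ 4 * v₀ ^ 4 * hd

/-- No affine point of `E` over `ℚ(t)` specializes to the point at infinity. -/
theorem regularAt_of_equation {α₀ t₀ : ℚ} (h0 : NonsquareProducts α₀)
    (ht : t₀ = 1 / (α₀ - α₀ ^ 3)) {x y : RatFunc ℚ} (h : genericCurve.Equation x y) :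
    RegularAt t₀ x ∧ RegularAt t₀ y := by
  have heq : y ^ 2 = x ^ 3 - RatFunc.X ^ 2 * x + RatFunc.X ^ 2 := by
    have := (WeierstrassCurve.Affine.equation_iff _ _).1 h
    simp only [genericCurve, curve] at this
    linear_combination this
  set u := x.num with hu
  set v := x.denom with hv
  have hv0 : v ≠ 0 := x.denom_ne_zero
  have hvK : algebraMap ℚ[X] (RatFunc ℚ) v ≠ 0 := RatFunc.algebraMap_ne_zero hv0
  have hx : x = algebraMap _ _ u / algebraMap _ _ v := (RatFunc.num_div_denom x).symm
  have hsq : (y * algebraMap _ _ v ^ 2) ^ 2 = algebraMap ℚ[X] (RatFunc ℚ)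
      (v * (u ^ 3 - X ^ 2 * u * v ^ 2 + X ^ 2 * v ^ 3)) := by
    rw [mul_pow, heq, hx]
    simp only [map_mul, map_add, map_sub, map_pow, RatFunc.algebraMap_X]
    field_simp
  obtain ⟨m, hm⟩ : ∃ m, algebraMap ℚ[X] (RatFunc ℚ) m = y * algebraMap _ _ v ^ 2 :=
    IsIntegrallyClosed.exists_algebraMap_eq_of_isIntegral_pow two_pos
      (by rw [hsq]; exact isIntegral_algebraMap)
  have hmeq : m ^ 2 = v * (u ^ 3 - X ^ 2 * u * v ^ 2 + X ^ 2 * v ^ 3) := by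
    apply RatFunc.algebraMap_injective ℚ
    rw [map_pow, hm, hsq]
  have hd := h0.sub_pow_ne_zero
  have hreg : RegularAt t₀ x := by
    intro hpole
    rw [← hv] at hpole
    have hu0 : u.eval t₀ ≠ 0 := by
      intro hu0
      obtain ⟨f, g, hfg⟩ := RatFunc.isCoprime_num_denom x
      have := congrArg (eval t₀) hfg
      rw [← hu, ← hv] at this
      simp [hu0, hpole] at this
    rw [one_div] at ht
    set n := u.natDegree + v.natDegree + m.natDegree
    have hun : u.natDegree ≤ n := by omega
    have hvn : v.natDegree ≤ n := by omega
    have hQ0 : (pullback n v).eval α₀ = 0 := by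
      simp [eval_pullback hvn hd, ← ht, hpole]
    have hP0 : ((X - X ^ 3) ^ 2 * pullback n u -
        X * (X - X ^ 3) * pullback n v).eval α₀ ≠ 0 := by
      simp [hQ0, eval_pullback hun hd, ← ht, hd, hu0]
    obtain ⟨k, r, s, z, hk, -⟩ := exists_kernelTriple h0 false hP0 (pullback_ne_zero hv0) hQ0
      (pullback_equation hmeq hun hvn (by omega) rfl rfl)
    exact not_kernelTriple h0 hk
  refine ⟨hreg, fun hy => ?_⟩
  have hyv : y = algebraMap _ _ m / algebraMap _ _ (v ^ 2) := by
    rw [map_pow, hm]; field_simp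
  have hdvd : y.denom ∣ v ^ 2 := by
    rw [hyv]; exact RatFunc.denom_div_dvd _ _
  have := eval_eq_zero_of_dvd_of_eval_eq_zero hdvd hy
  rw [eval_pow] at this
  exact hreg (pow_eq_zero_iff two_ne_zero |>.1 this)

/-! ### Injectivity of the specialization map -/

theorem RegularAt.of_sq {t₀ : ℚ} {f : RatFunc ℚ} (h : RegularAt t₀ (f ^ 2)) : RegularAt t₀ f := by
  intro hf
  have hpoly : f.num ^ 2 * (f ^ 2).denom = (f ^ 2).num * f.denom ^ 2 := by
    apply RatFunc.algebraMap_injective ℚ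
    have h1 := RatFunc.num_div_denom f
    have h2 := RatFunc.num_div_denom (f ^ 2)
    have d1 := RatFunc.algebraMap_ne_zero f.denom_ne_zero
    have d2 := RatFunc.algebraMap_ne_zero (f ^ 2).denom_ne_zero
    rw [div_eq_iff d1] at h1
    rw [div_eq_iff d2] at h2
    simp only [map_mul, map_pow]
    rw [h1, h2]; ring
  have h0 := congrArg (eval t₀) hpoly
  simp only [eval_mul, eval_pow, hf, ne_eq, OfNat.ofNat_ne_zero, not_false_eq_true, zero_pow,
    mul_zero, mul_eq_zero, pow_eq_zero_iff] at h0
  obtain ⟨u, v, huv⟩ := RatFunc.isCoprime_num_denom f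
  have := congrArg (eval t₀) huv
  simp [h0.resolve_right h, hf] at this

theorem curve_Δ_ne_zero {t₀ : ℚ} (ht : t₀ ≠ 0) : (curve t₀).Δ ≠ 0 := by
  intro h
  have h1 : 16 * t₀ ^ 4 * (4 * t₀ ^ 2 - 27) = 0 := by
    rw [← h]
    simp [curve, WeierstrassCurve.Δ, WeierstrassCurve.b₂, WeierstrassCurve.b₄,
      WeierstrassCurve.b₆, WeierstrassCurve.b₈]
    ring
  have h2 : 4 * t₀ ^ 2 - 27 = 0 := by simpa [ht] using h1
  -- The discriminant is `16 t₀⁴ (4 t₀² - 27)`, and `27` is not a rational square.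
  have h3 : IsSquare (27 : ℚ) := ⟨2 * t₀, by linear_combination -h2⟩
  norm_num at h3

/-- The line through `(x₁, y₁)` and `(x₂, -y₂)` meets `E` in a further point, regular by
`regularAt_of_equation`, so its slope `L` is regular at `t₀`. If the two points were distinct, the
equations `L (x₁ - x₂) = y₁ + y₂` and `L (y₁ - y₂) = x₁² + x₁ x₂ + x₂² - t²` would specialize to
`2 y = 0` and `3 x² - t₀² = 0`, a singular point. -/
theorem eq_of_valueAt_eq {α₀ t₀ : ℚ} (h0 : NonsquareProducts α₀)
    (ht : t₀ = 1 / (α₀ - α₀ ^ 3)) (hΔ : (curve t₀).Δ ≠ 0) {x₁ y₁ x₂ y₂ : RatFunc ℚ}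
    (h₁ : genericCurve.Nonsingular x₁ y₁) (h₂ : genericCurve.Nonsingular x₂ y₂)
    (hx : valueAt t₀ x₁ = valueAt t₀ x₂) (hy : valueAt t₀ y₁ = valueAt t₀ y₂) :
    x₁ = x₂ ∧ y₁ = y₂ := by
  classical
  by_contra hne
  obtain ⟨rx₁, ry₁⟩ := regularAt_of_equation h0 ht h₁.1
  obtain ⟨rx₂, ry₂⟩ := regularAt_of_equation h0 ht h₂.1
  have e₁ := (WeierstrassCurve.Affine.equation_iff _ _).1 h₁.1
  have e₂ := (WeierstrassCurve.Affine.equation_iff _ _).1 h₂.1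
  simp only [genericCurve, curve] at e₁ e₂
  have hneg : genericCurve.negY x₂ (-y₂) = y₂ := by
    simp [WeierstrassCurve.Affine.negY, genericCurve, curve]
  have h₂' : genericCurve.Equation x₂ (-y₂) := by
    rw [← WeierstrassCurve.Affine.equation_neg, hneg]
    exact h₂.1
  have hxy : ¬ (x₁ = x₂ ∧ y₁ = genericCurve.negY x₂ (-y₂)) := by rwa [hneg]
  set L := genericCurve.slope x₁ x₂ y₁ (-y₂) with hL
  have rX₃ := (regularAt_of_equation h0 ht
    (WeierstrassCurve.Affine.equation_add h₁.1 h₂' hxy)).1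
  have rL : RegularAt t₀ L := by
    apply RegularAt.of_sq
    rw [← hL] at rX₃
    convert (rX₃.add rx₁).add rx₂ using 1
    simp [WeierstrassCurve.Affine.addX, genericCurve, curve]
    ring
  have key : valueAt t₀ y₁ = 0 ∧
      L * y₁ + RatFunc.X * RatFunc.X = x₁ * x₁ + x₁ * x₂ + x₂ * x₂ + L * y₂ := by
    by_cases hxx : x₁ = x₂
    · subst hxx
      have hyy : y₁ ≠ y₂ := fun h => hne ⟨rfl, h⟩
      have hsum : y₁ + y₂ = 0 := by
        have : (y₁ - y₂) * (y₁ + y₂) = 0 := by linear_combination e₁ - e₂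
        exact (mul_eq_zero.1 this).resolve_left (sub_ne_zero.2 hyy)
      refine ⟨?_, ?_⟩
      · have := congrArg (valueAt t₀) hsum
        rw [valueAt_add ry₁ ry₂, ← hy] at this
        simp [valueAt] at this ⊢
        linarith
      · have hy1 : y₁ ≠ 0 := fun h => hyy (by rw [h] at hsum ⊢; simpa using hsum.symm)
        have h2 : (2 : RatFunc ℚ) * y₁ ≠ 0 := mul_ne_zero two_ne_zero hy1
        have hLe : L * (2 * y₁) = 3 * x₁ ^ 2 - RatFunc.X ^ 2 := by
          rw [hL, WeierstrassCurve.Affine.slope_of_Y_ne rfl (by rwa [hneg])]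
          simp only [WeierstrassCurve.Affine.negY, genericCurve, curve]
          rw [div_mul_eq_mul_div, div_eq_iff (by convert h2 using 1; ring)]
          ring
        linear_combination hLe - L * hsum
    · have hsub := sub_ne_zero.2 hxx
      have hLe : L * (x₁ - x₂) = y₁ + y₂ := by
        rw [hL, WeierstrassCurve.Affine.slope_of_X_ne hxx, div_mul_cancel₀ _ hsub]
        ring
      refine ⟨?_, ?_⟩
      · have : L * x₁ = y₁ + y₂ + L * x₂ := by linear_combination hLe
        have := congrArg (valueAt t₀) this
        rw [valueAt_add (ry₁.add ry₂) (rL.mul rx₂), valueAt_add ry₁ ry₂, valueAt_mul rL rx₁,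
          valueAt_mul rL rx₂, hx, ← hy] at this
        linarith
      · apply mul_left_cancel₀ hsub
        linear_combination (y₁ - y₂) * hLe + e₁ - e₂
  obtain ⟨hy0, hLe⟩ := key
  have hX := regularAt_X t₀
  have hv := congrArg (valueAt t₀) hLe
  rw [valueAt_add (rL.mul ry₁) (hX.mul hX), valueAt_mul rL ry₁, valueAt_mul hX hX, valueAt_X,
    valueAt_add (((rx₁.mul rx₁).add (rx₁.mul rx₂)).add (rx₂.mul rx₂)) (rL.mul ry₂),
    valueAt_add ((rx₁.mul rx₁).add (rx₁.mul rx₂)) (rx₂.mul rx₂),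
    valueAt_add (rx₁.mul rx₁) (rx₁.mul rx₂), valueAt_mul rx₁ rx₁, valueAt_mul rx₁ rx₂,
    valueAt_mul rx₂ rx₂, valueAt_mul rL ry₂, ← hy, ← hx, hy0] at hv
  have hns := nonsingular_valueAt hΔ h₁ rx₁ ry₁
  rw [WeierstrassCurve.Affine.nonsingular_iff, hy0] at hns
  simp only [curve] at hns
  rcases hns.2 with h | h
  · exact h (by linear_combination hv)
  · exact h (by ring)

theorem specialization_injective {α₀ t₀ : ℚ} (h0 : NonsquareProducts α₀)
    (ht : t₀ = 1 / (α₀ - α₀ ^ 3)) :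
    ∃ hΔ : (curve t₀).Δ ≠ 0, Function.Injective (specialization t₀ hΔ) := by
  have ht0 : t₀ ≠ 0 := by rw [ht]; exact one_div_ne_zero h0.sub_pow_ne_zero
  have hΔ := curve_Δ_ne_zero ht0
  refine ⟨hΔ, ?_⟩
  have hsome : ∀ (x y : RatFunc ℚ) (h : genericCurve.Nonsingular x y),
      ∃ h', specialization t₀ hΔ (.some x y h) = .some (valueAt t₀ x) (valueAt t₀ y) h' := by
    intro x y h
    have hr := regularAt_of_equation h0 ht h.1
    exact ⟨nonsingular_valueAt hΔ h hr.1 hr.2, dif_pos hr⟩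
  have hzero : specialization t₀ hΔ .zero = .zero := rfl
  rintro (_ | ⟨x₁, y₁, h₁⟩) (_ | ⟨x₂, y₂, h₂⟩) h
  · rfl
  · obtain ⟨h', e⟩ := hsome x₂ y₂ h₂
    rw [hzero, e] at h
    cases h
  · obtain ⟨h', e⟩ := hsome x₁ y₁ h₁
    rw [hzero, e] at h
    cases h
  · obtain ⟨h₁', e₁⟩ := hsome x₁ y₁ h₁
    obtain ⟨h₂', e₂⟩ := hsome x₂ y₂ h₂
    rw [e₁, e₂, WeierstrassCurve.Affine.Point.some.injEq] at h
    obtain ⟨rfl, rfl⟩ := eq_of_valueAt_eq h0 ht hΔ h₁ h₂ h.1 h.2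
    rfl

/-- The values of `Phi` at `-3/2` are `-1`, `-3/2`, `-5/2`, `-1/2`, `11/4` and `23/4`. -/
theorem nonsquareProducts_neg_three_halves : NonsquareProducts (-3 / 2) := by
  classical
  intro S hS hne
  set U : Finset ℤ[X] := {-1, X, X - 1, X + 1, 3 * X ^ 2 - 4, 3 * X ^ 2 - 1} with hU
  have hSU : S ⊆ U := by
    intro f hf
    simpa [Phi, hU] using hS hf
  have hprod : ∏ h ∈ S, h = ∏ h ∈ U, if h ∈ S then h else 1 := by
    rw [← Finset.prod_filter, Finset.filter_mem_eq_inter, Finset.inter_eq_right.2 hSU]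
  -- The elements of `Phi` are distinct because their values at `2` are.
  have hdist : ∀ {f g : ℤ[X]}, eval 2 f ≠ eval 2 g → f ≠ g := fun h hfg => h (hfg ▸ rfl)
  have hU' : ∏ h ∈ U, (if h ∈ S then h else 1) =
      (if -1 ∈ S then -1 else 1) * ((if X ∈ S then X else 1) *
      ((if X - 1 ∈ S then X - 1 else 1) * ((if X + 1 ∈ S then X + 1 else 1) *
      ((if 3 * X ^ 2 - 4 ∈ S then 3 * X ^ 2 - 4 else 1) *
      (if 3 * X ^ 2 - 1 ∈ S then 3 * X ^ 2 - 1 else 1))))) := by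
    rw [hU, Finset.prod_insert, Finset.prod_insert, Finset.prod_insert, Finset.prod_insert,
      Finset.prod_insert, Finset.prod_singleton]
    all_goals
      simp only [Finset.mem_insert, Finset.mem_singleton, not_or]
      repeat' apply And.intro
    all_goals exact hdist (by simp)
  obtain ⟨f, hf⟩ := hne
  have hfU := hSU hf
  rw [hprod, hU']
  simp only [hU, Finset.mem_insert, Finset.mem_singleton] at hfU
  simp only [map_mul, apply_ite (aeval (-3 / 2 : ℚ)), map_neg, map_one, map_sub, map_add, map_pow,
    aeval_X, map_ofNat]
  have hsome : -1 ∈ S ∨ X ∈ S ∨ X - 1 ∈ S ∨ X + 1 ∈ S ∨ 3 * X ^ 2 - 4 ∈ S ∨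
      3 * X ^ 2 - 1 ∈ S := by
    rcases hfU with rfl | rfl | rfl | rfl | rfl | rfl <;> simp [hf]
  by_cases h₁ : -1 ∈ S <;> by_cases h₂ : X ∈ S <;> by_cases h₃ : X - 1 ∈ S <;>
    by_cases h₄ : X + 1 ∈ S <;> by_cases h₅ : 3 * X ^ 2 - 4 ∈ S <;>
    by_cases h₆ : 3 * X ^ 2 - 1 ∈ S <;>
    simp only [h₁, h₂, h₃, h₄, h₅, h₆, or_self, if_true, if_false] at hsome ⊢ <;> norm_num

/-- Part one: the criterion for `t₀ = 1/(α₀ - α₀³)`. Part two: the example `t₀ = 8/15`. -/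
theorem proposition3p2 :
    (∀ α₀ t₀ : ℚ, t₀ = 1 / (α₀ - α₀ ^ 3) →
      (∀ S : Finset (Polynomial ℤ), (S : Set (Polynomial ℤ)) ⊆ Phi → S.Nonempty →
        ¬ IsSquare (Polynomial.aeval α₀ (∏ h ∈ S, h))) →
      ∃ hΔ : (curve t₀).Δ ≠ 0, Function.Injective (specialization t₀ hΔ)) ∧
    (∃ hΔ : (curve (8 / 15 : ℚ)).Δ ≠ 0,
      Function.Injective (specialization (8 / 15) hΔ)) :=
  ⟨fun _ _ ht h0 => specialization_injective h0 ht,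
    specialization_injective nonsquareProducts_neg_three_halves (by norm_num)⟩
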